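/- Let $\mathbb K=\mathbb R$ (resp. $\mathbb K=\mathbb C$) and let $M$ be a smooth (resp. complex) manifold of dimension $2n$ over $\mathbb K$; all bivector fields are smooth (resp. holomorphic) sections of $\Lambda^2TM$. A Poisson structure on $M$ is a bivector field $\Pi$ whose Schouten bracket $[\Pi,\Pi]$ vanishes; write $\#_\Pi:T^*M\to TM$ for the induced map. It is called log-symplectic if the section $\Pi^n=\Pi\wedge\dots\wedge\Pi$ of $\Lambda^{2n}TM$ meets the zero section transversely. Let $(\Pi_1,\Pi_2)$ be a bi-Poisson structure on $M$, i.e. a pair of linearly independent bivector fields such that every linear combination $t_1\Pi_1+t_2\Pi_2$ ($t_1,t_2\in\mathbb K$) is a Poisson structure, and suppose that $\Pi_1$ is symplectic, i.e. $\#_{\Pi_1}$ is an isomorphism at every point. Let $R=\#_{\Pi_2}\circ\#_{\Pi_1}^{-1}\in\operatorname{End}(TM)$ be the recursion operator. At each $m\in M$ the characteristic polynomial of $R_m$ is the square of a unique monic polynomial $\mu_m(\lambda)=\lambda^n+p_{n-1}(m)\lambda^{n-1}+\dots+p_0(m)$, the Pfaffian polynomial of $R_m$. If $p=(p_0,\dots,p_{n-1}):M\to\mathbb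 K^n$ is a submersion, then $\Pi_2-\lambda\Pi_1$ is a log-symplectic Poisson structure for every $\lambda\in\mathbb K$. -/

import Mathlib

open Bundle Manifold Polynomial
open scoped ContDiff

noncomputable section

set_option linter.unusedSectionVars false

namespace BiPoisson

/-! ### Linear algebra of bivectors

For a finite-dimensional space `V`, an element of `Λᵏ V` is treated as an alternating `k`-form
on the dual space `V*`. -/

section LinearAlgebra

variable {𝕜 : Type*} [RCLike 𝕜] {V : Type*} [AddCommGroup V] [Module 𝕜 V] [TopologicalSpace V]
  [IsTopologicalAddGroup V] [ContinuousSMul 𝕜 V]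

theorem bivector_add_left (P : (V →L[𝕜] 𝕜) [⋀^Fin 2]→L[𝕜] 𝕜) (α α' β : V →L[𝕜] 𝕜) :
    P ![α + α', β] = P ![α, β] + P ![α', β] := by
  have h := P.map_update_add ![α, β] 0 α α'
  have e (x : V →L[𝕜] 𝕜) : Function.update ![α, β] 0 x = ![x, β] := by
    ext i; fin_cases i <;> simp
  simpa only [e] using h

theorem bivector_smul_left (P : (V →L[𝕜] 𝕜) [⋀^Fin 2]→L[𝕜] 𝕜) (c : 𝕜) (α β : V →L[𝕜] 𝕜) :
    P ![c • α, β] = c • P ![α, β] := by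
  have h := P.map_update_smul ![α, β] 0 c α
  have e (x : V →L[𝕜] 𝕜) : Function.update ![α, β] 0 x = ![x, β] := by
    ext i; fin_cases i <;> simp
  simpa only [e] using h

theorem bivector_add_right (P : (V →L[𝕜] 𝕜) [⋀^Fin 2]→L[𝕜] 𝕜) (α β β' : V →L[𝕜] 𝕜) :
    P ![α, β + β'] = P ![α, β] + P ![α, β'] := by
  have h := P.map_update_add ![α, β] 1 β β'
  have e (x : V →L[𝕜] 𝕜) : Function.update ![α, β] 1 x = ![α, x] := by
    ext i; fin_cases i <;> simp
  simpa only [e] using h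

theorem bivector_smul_right (P : (V →L[𝕜] 𝕜) [⋀^Fin 2]→L[𝕜] 𝕜) (c : 𝕜) (α β : V →L[𝕜] 𝕜) :
    P ![α, c • β] = c • P ![α, β] := by
  have h := P.map_update_smul ![α, β] 1 c β
  have e (x : V →L[𝕜] 𝕜) : Function.update ![α, β] 1 x = ![α, x] := by
    ext i; fin_cases i <;> simp
  simpa only [e] using h

/-- The multilinear form `α ↦ ∏ i, P(α (i, 0), α (i, 1))` in `2k` covectors, which are indexed by
`Fin k × Fin 2`. -/
def pairProduct (k : ℕ) (P : (V →L[𝕜] 𝕜) [⋀^Fin 2]→L[𝕜] 𝕜) :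
    ContinuousMultilinearMap 𝕜 (fun _ : Fin k × Fin 2 => V →L[𝕜] 𝕜) 𝕜 where
  toFun α := ∏ i, P ![α (i, 0), α (i, 1)]
  map_update_add' := by
    intro _ α ⟨j, a⟩ x y
    have key (z : V →L[𝕜] 𝕜) : ∏ i ∈ Finset.univ.erase j,
        P ![Function.update α (j, a) z (i, 0), Function.update α (j, a) z (i, 1)] =
        ∏ i ∈ Finset.univ.erase j, P ![α (i, 0), α (i, 1)] := by
      refine Finset.prod_congr rfl fun i hi => ?_
      have hij : i ≠ j := Finset.ne_of_mem_erase hi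
      rw [Function.update_of_ne (by simp [hij]), Function.update_of_ne (by simp [hij])]
    obtain rfl : ‹DecidableEq (Fin k × Fin 2)› = instDecidableEqProd := Subsingleton.elim _ _
    simp only [← Finset.mul_prod_erase Finset.univ _ (Finset.mem_univ j), key, ← add_mul]
    congr 1
    fin_cases a <;> simp [bivector_add_left, bivector_add_right]
  map_update_smul' := by
    intro _ α ⟨j, a⟩ c x
    have key (z : V →L[𝕜] 𝕜) : ∏ i ∈ Finset.univ.erase j,
        P ![Function.update α (j, a) z (i, 0), Function.update α (j, a) z (i, 1)] =
        ∏ i ∈ Finset.univ.erase j, P ![α (i, 0), α (i, 1)] := by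
      refine Finset.prod_congr rfl fun i hi => ?_
      have hij : i ≠ j := Finset.ne_of_mem_erase hi
      rw [Function.update_of_ne (by simp [hij]), Function.update_of_ne (by simp [hij])]
    obtain rfl : ‹DecidableEq (Fin k × Fin 2)› = instDecidableEqProd := Subsingleton.elim _ _
    simp only [← Finset.mul_prod_erase Finset.univ _ (Finset.mem_univ j), key, ← smul_mul_assoc]
    congr 1
    fin_cases a <;> simp [bivector_smul_left, bivector_smul_right]
  cont := by
    refine continuous_finsetProd _ fun i _ => P.cont.comp ?_
    refine continuous_pi fun a => ?_
    fin_cases a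
    · exact continuous_apply (i, 0)
    · exact continuous_apply (i, 1)

/-- The `k`-th exterior power `Pᵏ = P ∧ ⋯ ∧ P ∈ Λ²ᵏ V` of a bivector `P ∈ Λ² V`:
`Pᵏ(α) = 2⁻ᵏ ∑ σ, sign σ ∏ i, P(α (σ (i, 0)), α (σ (i, 1)))`. -/
def wedgePow (k : ℕ) (P : (V →L[𝕜] 𝕜) [⋀^Fin 2]→L[𝕜] 𝕜) :
    (V →L[𝕜] 𝕜) [⋀^Fin k × Fin 2]→L[𝕜] 𝕜 :=
  ((2 : 𝕜) ^ k)⁻¹ • ContinuousMultilinearMap.alternatization (pairProduct k P)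

variable [T2Space V] [FiniteDimensional 𝕜 V]

/-- The map `♯_P : V* → V`, characterised by `β (♯_P α) = P(α, β)`. -/
def sharp (P : (V →L[𝕜] 𝕜) [⋀^Fin 2]→L[𝕜] 𝕜) : (V →L[𝕜] 𝕜) →ₗ[𝕜] V :=
  (Module.evalEquiv 𝕜 V).symm.toLinearMap ∘ₗ
    LinearMap.mk₂ 𝕜 (fun (α : V →L[𝕜] 𝕜) (β : Module.Dual 𝕜 V) =>
        P ![α, LinearMap.toContinuousLinearMap β])
      (fun α α' β => bivector_add_left P α α' _) (fun c α β => bivector_smul_left P c α _)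
      (fun α β β' => by simp only [map_add, bivector_add_right])
      (fun c α β => by simp only [map_smul, bivector_smul_right])

theorem apply_sharp (P : (V →L[𝕜] 𝕜) [⋀^Fin 2]→L[𝕜] 𝕜) (α β : V →L[𝕜] 𝕜) :
    β (sharp P α) = P ![α, β] := by
  have h := LinearMap.congr_fun ((Module.evalEquiv 𝕜 V).apply_symm_apply
    (LinearMap.mk₂ 𝕜 (fun (α : V →L[𝕜] 𝕜) (β : Module.Dual 𝕜 V) =>
        P ![α, LinearMap.toContinuousLinearMap β])
      (fun α α' β => bivector_add_left P α α' _) (fun c α β => bivector_smul_left P c α _)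
      (fun α β β' => by simp only [map_add, bivector_add_right])
      (fun c α β => by simp only [map_smul, bivector_smul_right]) α)) (β : V →ₗ[𝕜] 𝕜)
  exact h

end LinearAlgebra

section PfaffianPolynomial

variable {𝕜 : Type*} [RCLike 𝕜] {V : Type*} [AddCommGroup V] [Module 𝕜 V] [FiniteDimensional 𝕜 V]

/-- The Pfaffian polynomial `μ_R` of an endomorphism `R` whose characteristic polynomial is a
square: the monic polynomial with `χ_R = μ_R²`. -/
def pfaffianPolynomial (R : V →ₗ[𝕜] V) : 𝕜[X] :=
  Classical.epsilon fun q : 𝕜[X] => q.Monic ∧ q ^ 2 = R.charpoly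

theorem pfaffianPolynomial_eq (R : V →ₗ[𝕜] V) (q : 𝕜[X]) (hq : q.Monic)
    (hq' : q ^ 2 = R.charpoly) : pfaffianPolynomial R = q := by
  obtain ⟨h, h'⟩ : (pfaffianPolynomial R).Monic ∧ pfaffianPolynomial R ^ 2 = R.charpoly :=
    Classical.epsilon_spec (p := fun q : 𝕜[X] => q.Monic ∧ q ^ 2 = R.charpoly) ⟨q, hq, hq'⟩
  rcases sq_eq_sq_iff_eq_or_eq_neg.1 (h'.trans hq'.symm) with e | e
  · exact e
  · have h1 : (-q).leadingCoeff = 1 := e ▸ h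
    rw [Polynomial.leadingCoeff_neg, hq.leadingCoeff] at h1
    have h2 : (1 : 𝕜) + 1 = 0 := by nth_rewrite 1 [← h1]; ring
    norm_num at h2

end PfaffianPolynomial

/-! ### Bivector fields on manifolds -/

section Manifold

variable {𝕜 : Type*} [RCLike 𝕜] {E : Type*} [NormedAddCommGroup E] [NormedSpace 𝕜 E]
  {M : Type*} [TopologicalSpace M] [ChartedSpace E M]

/-- The fibre `Λ^ι T_m M` of a power of the tangent bundle, as the space of alternating forms on
the cotangent space `T_m^* M`, with arguments indexed by the finite type `ι`. -/
abbrev Multivector (𝕜 : Type*) [RCLike 𝕜] {E : Type*} [NormedAddCommGroup E] [NormedSpace 𝕜 E]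
    {M : Type*} [TopologicalSpace M] [ChartedSpace E M] (ι : Type*) (m : M) : Type _ :=
  (TangentSpace 𝓘(𝕜, E) m →L[𝕜] Trivial M 𝕜 m) [⋀^ι]→L[𝕜] Trivial M 𝕜 m

/-- The model fibre of `Λ^ι TM`. -/
abbrev MultivectorModel (𝕜 : Type*) [RCLike 𝕜] (E : Type*) [NormedAddCommGroup E]
    [NormedSpace 𝕜 E] (ι : Type*) : Type _ :=
  (E →L[𝕜] 𝕜) [⋀^ι]→L[𝕜] 𝕜

/-- A (not necessarily smooth) section of `Λ^ι TM`. -/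
abbrev MultivectorField (𝕜 : Type*) [RCLike 𝕜] {E : Type*} [NormedAddCommGroup E]
    [NormedSpace 𝕜 E] (M : Type*) [TopologicalSpace M] [ChartedSpace E M] (ι : Type*) : Type _ :=
  ∀ m : M, Multivector 𝕜 (E := E) ι m

/-- A section of `Λ^ι TM` as a map from `M` to the total space of the bundle. -/
def toTotal {ι : Type*} (s : MultivectorField 𝕜 (E := E) M ι) (m : M) :
    TotalSpace (MultivectorModel 𝕜 E ι) (Multivector 𝕜 (E := E) (M := M) ι) :=
  ⟨m, s m⟩

/-- Smooth sections of `Λ^ι TM` (holomorphic ones if `𝕜 = ℂ`). -/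
def IsSmooth [IsManifold 𝓘(𝕜, E) ∞ M] {ι : Type*} [Fintype ι]
    (s : MultivectorField 𝕜 (E := E) M ι) : Prop :=
  ContMDiff 𝓘(𝕜, E) (𝓘(𝕜, E).prod 𝓘(𝕜, MultivectorModel 𝕜 E ι)) ∞ (toTotal s)

/-- `s` meets the zero section of `Λ^ι TM` transversely: wherever `s m = 0`, the images of the
differentials of `s` and of the zero section span the tangent space of the total space. -/
def IsTransverseToZero [IsManifold 𝓘(𝕜, E) ∞ M] {ι : Type*} [Fintype ι]
    (s : MultivectorField 𝕜 (E := E) M ι) : Prop :=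
  ∀ m : M, s m = 0 →
    LinearMap.range
        (mfderiv 𝓘(𝕜, E) (𝓘(𝕜, E).prod 𝓘(𝕜, MultivectorModel 𝕜 E ι)) (toTotal s) m :
          E →L[𝕜] E × MultivectorModel 𝕜 E ι).toLinearMap ⊔
      LinearMap.range
        (mfderiv 𝓘(𝕜, E) (𝓘(𝕜, E).prod 𝓘(𝕜, MultivectorModel 𝕜 E ι))
          (toTotal (0 : MultivectorField 𝕜 (E := E) M ι)) m :
          E →L[𝕜] E × MultivectorModel 𝕜 E ι).toLinearMap = ⊤

/-- The bracket `{f, g} = P(df, dg)` of two functions. -/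
def bracket (P : MultivectorField 𝕜 (E := E) M (Fin 2)) (f g : M → 𝕜) (x : M) : 𝕜 :=
  P x ![mfderiv 𝓘(𝕜, E) 𝓘(𝕜, 𝕜) f x, mfderiv 𝓘(𝕜, E) 𝓘(𝕜, 𝕜) g x]

/-- The function `α ∘ φ` near `m`, where `φ` is the preferred chart at `m`. Its differential at `m`
is `α`, since `dφ_m` is the identification `T_m M = E`. -/
def coordFun (m : M) (α : TangentSpace 𝓘(𝕜, E) m →L[𝕜] 𝕜) (x : M) : 𝕜 :=
  α (extChartAt 𝓘(𝕜, E) m x : E)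

/-- The Schouten bracket `[P, Q]` of two bivector fields, a trivector field, evaluated at `m` on
three covectors: with `f, g, h` functions that are linear in the chart at `m` and have
differentials `α, β, γ` there, it is the cyclic sum of `{{f, g}_P, h}_Q + {{f, g}_Q, h}_P`;
in coordinates, the cyclic sum over `(i, j, k)` of `Pⁱʲ,ₗ Qˡᵏ + Qⁱʲ,ₗ Pˡᵏ`. -/
def schouten (P Q : MultivectorField 𝕜 (E := E) M (Fin 2)) (m : M)
    (α β γ : TangentSpace 𝓘(𝕜, E) m →L[𝕜] 𝕜) : 𝕜 :=
  let J (f g h : M → 𝕜) : 𝕜 :=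
    bracket Q (bracket P f g) h m + bracket P (bracket Q f g) h m
  J (coordFun m α) (coordFun m β) (coordFun m γ) +
    J (coordFun m β) (coordFun m γ) (coordFun m α) +
    J (coordFun m γ) (coordFun m α) (coordFun m β)

/-- Poisson structures: smooth (holomorphic) bivector fields with `[P, P] = 0`. -/
structure IsPoisson [IsManifold 𝓘(𝕜, E) ∞ M]
    (P : MultivectorField 𝕜 (E := E) M (Fin 2)) : Prop where
  smooth : IsSmooth P
  schouten_self : ∀ m α β γ, schouten P P m α β γ = 0

/-- Bi-Poisson structures: pairs of linearly independent bivector fields all of whose linear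
combinations are Poisson structures. -/
structure IsBiPoisson [IsManifold 𝓘(𝕜, E) ∞ M]
    (P₁ P₂ : MultivectorField 𝕜 (E := E) M (Fin 2)) : Prop where
  linearIndependent : LinearIndependent 𝕜 ![P₁, P₂]
  isPoisson : ∀ t₁ t₂ : 𝕜, IsPoisson (t₁ • P₁ + t₂ • P₂)

/-- The section `Pᵏ` of `Λ²ᵏ TM`. -/
def fieldPow (k : ℕ) (P : MultivectorField 𝕜 (E := E) M (Fin 2)) :
    MultivectorField 𝕜 (E := E) M (Fin k × Fin 2) :=
  fun m => wedgePow (V := TangentSpace 𝓘(𝕜, E) m) k (P m)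

/-- Log-symplectic structures on a manifold of dimension `2n`: Poisson structures `P` such that
`Pⁿ` meets the zero section of `Λ²ⁿ TM` transversely. -/
structure IsLogSymplectic [IsManifold 𝓘(𝕜, E) ∞ M] (n : ℕ)
    (P : MultivectorField 𝕜 (E := E) M (Fin 2)) : Prop where
  isPoisson : IsPoisson P
  transverse : IsTransverseToZero (fieldPow n P)

instance [FiniteDimensional 𝕜 E] (m : M) : FiniteDimensional 𝕜 (TangentSpace 𝓘(𝕜, E) m) :=
  inferInstanceAs (FiniteDimensional 𝕜 E)

instance (m : M) : T2Space (TangentSpace 𝓘(𝕜, E) m) :=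
  inferInstanceAs (T2Space E)

variable [FiniteDimensional 𝕜 E]

/-- The map `♯_P : T_m^* M → T_m M`. -/
def fieldSharp (P : MultivectorField 𝕜 (E := E) M (Fin 2)) (m : M) :
    (TangentSpace 𝓘(𝕜, E) m →L[𝕜] 𝕜) →ₗ[𝕜] TangentSpace 𝓘(𝕜, E) m :=
  sharp (V := TangentSpace 𝓘(𝕜, E) m) (P m)

/-- `P` is symplectic at every point, i.e. its degeneracy locus is empty. -/
def IsNondegenerate (P : MultivectorField 𝕜 (E := E) M (Fin 2)) : Prop :=
  ∀ m, Function.Bijective (fieldSharp P m)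

/-- The recursion operator `R = ♯_{P₂} ∘ ♯_{P₁}⁻¹`, an endomorphism of `TM`. -/
def recursionOperator (P₁ P₂ : MultivectorField 𝕜 (E := E) M (Fin 2)) (h₁ : IsNondegenerate P₁)
    (m : M) : TangentSpace 𝓘(𝕜, E) m →ₗ[𝕜] TangentSpace 𝓘(𝕜, E) m :=
  fieldSharp P₂ m ∘ₗ (LinearEquiv.ofBijective (fieldSharp P₁ m) (h₁ m)).symm.toLinearMap

/-- The map `M → 𝕜ⁿ` given by the coefficients of `1, X, …, Xⁿ⁻¹` in the Pfaffian polynomial of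
the recursion operator (a monic polynomial of degree `n` if `dim M = 2n`). -/
def pfaffianMap (n : ℕ) (P₁ P₂ : MultivectorField 𝕜 (E := E) M (Fin 2))
    (h₁ : IsNondegenerate P₁) (m : M) : Fin n → 𝕜 :=
  fun i => (pfaffianPolynomial (recursionOperator P₁ P₂ h₁ m)).coeff i

end Manifold

end BiPoisson

end

open scoped Topology

set_option linter.unusedSectionVars false

/-! The heart is the pointwise identity `(P₂ - c P₁)ⁿ = (-1)ⁿ μ(c) P₁ⁿ`, with `μ` the Pfaffian
polynomial of the recursion operator. Since `P₁ⁿ` vanishes nowhere, it is a frame of the line bundle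
`Λ²ⁿ TM`. The zeros of `(P₂ - c P₁)ⁿ` are therefore those of the scalar function `μ(c)`, and
transversality means that this function has nonzero differential at its zeros. Now `μ(c)` is `cⁿ + ∑
pᵢ cⁱ`, a nonconstant affine function of `p` when `n > 0`, so it is a submersion as soon as `p` is
one; for `n = 0` it equals `1` and has no zeros.

The identity rests on "Pfaffian squared is determinant" (`wedgePow_sq_mul`), proved by comparison
with a symplectic family. Together with `det_toMatrix_sub_smul` it shows that the monic polynomial
`c ↦ (c P₁ - P₂)ⁿ / P₁ⁿ` squares to the characteristic polynomial (`pfaffianPolynomial_recursion`),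
and uniqueness of the monic root does the rest. Geometrically, `hasMFDerivAt_section` reduces
transversality in the total space to the derivative of the fibre component in a trivialization, and
`mfderiv_surjective_of_isSubmersionAt` turns the normal form of a submersion into surjectivity of
its differential. -/

namespace BiPoisson

/-! ### The standard symplectic matrix and its Pfaffian -/

section StandardForm

/-- The matrix of the standard symplectic form on `𝕂²ⁿ`, with basis vectors indexed by
`Fin n × Fin 2`. -/
def stdSymplectic (n : ℕ) (K : Type*) [CommRing K] :
    Matrix (Fin n × Fin 2) (Fin n × Fin 2) K :=
  fun a b => if a.1 = b.1 then (!![0, 1; -1, 0] : Matrix (Fin 2) (Fin 2) K) a.2 b.2 else 0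

theorem stdSymplectic_mul_self (n : ℕ) (K : Type*) [CommRing K] :
    stdSymplectic n K * stdSymplectic n K = -1 := by
  ext ⟨i, a⟩ ⟨j, b⟩
  rw [Matrix.mul_apply, Fintype.sum_prod_type, Finset.sum_eq_single i]
  · by_cases h : i = j
    · subst h
      fin_cases a <;> fin_cases b <;> simp [stdSymplectic]
    · simp [stdSymplectic, h]
  · intro k _ hk
    simp [stdSymplectic, hk.symm]
  · simp

theorem det_stdSymplectic_ne_zero (n : ℕ) (K : Type*) [Field K] :
    (stdSymplectic n K).det ≠ 0 := by
  have h := congrArg Matrix.det (stdSymplectic_mul_self n K)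
  rw [Matrix.det_mul, Matrix.det_neg, Matrix.det_one] at h
  intro h0
  rw [h0, zero_mul, mul_one] at h
  exact pow_ne_zero _ (neg_ne_zero.2 one_ne_zero) h.symm

/-- Each nonzero term of the Pfaffian sum of the standard symplectic form equals `1`. -/
theorem sign_mul_prod_stdSymplectic (n : ℕ) (K : Type*) [Field K]
    (σ : Equiv.Perm (Fin n × Fin 2)) :
    ((Equiv.Perm.sign σ : ℤ) : K) * ∏ i, stdSymplectic n K (σ (i, 0)) (σ (i, 1)) = 0 ∨
      ((Equiv.Perm.sign σ : ℤ) : K) * ∏ i, stdSymplectic n K (σ (i, 0)) (σ (i, 1)) = 1 := by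
  classical
  -- A term survives only if `σ` sends each pair `{(i, 0), (i, 1)}` into a single block; then `σ`
  -- permutes the blocks and possibly swaps inside each one.
  by_cases h : ∀ i, (σ (i, 0)).1 = (σ (i, 1)).1
  swap
  · left
    push Not at h
    obtain ⟨i, hi⟩ := h
    rw [Finset.prod_eq_zero (Finset.mem_univ i) (by simp [stdSymplectic, hi]), mul_zero]
  right
  have hne (i : Fin n) : (σ (i, 0)).2 ≠ (σ (i, 1)).2 := fun e => by
    have := σ.injective (Prod.ext (h i) e)
    simp at this
  let f (i : Fin n) : Fin n := (σ (i, 0)).1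
  have hf (i : Fin n) (a : Fin 2) : (σ (i, a)).1 = f i := by
    fin_cases a
    · rfl
    · exact (h i).symm
  have hsurj : Function.Surjective f := fun j => by
    obtain ⟨⟨i, a⟩, hia⟩ := σ.surjective (j, 0)
    exact ⟨i, by rw [← hf i a, hia]⟩
  let ρ : Equiv.Perm (Fin n) := Equiv.ofBijective f (Finite.surjective_iff_bijective.1 hsurj)
  let τ (i : Fin n) : Equiv.Perm (Fin 2) := if (σ (i, 0)).2 = 0 then 1 else Equiv.swap 0 1
  have hτ (i : Fin n) (a : Fin 2) : τ i a = (σ (i, a)).2 := by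
    have h1 := hne i
    simp only [τ]
    generalize hx : (σ (i, 0)).2 = x at *
    generalize hy : (σ (i, 1)).2 = y at *
    fin_cases a <;> simp only [Fin.zero_eta, Fin.mk_one, hx, hy] <;>
      fin_cases x <;> fin_cases y <;> simp_all
  have hσ : σ = Equiv.prodCongrLeft (fun _ : Fin 2 => ρ) * Equiv.prodCongrRight τ := by
    ext1 ⟨i, a⟩
    refine Prod.ext (hf i a) (hτ i a).symm
  -- The block permutation `ρ` acts once on each of the two columns, so its sign enters squared;
  -- only the swaps inside blocks count, and they cancel the signs of the matrix entries.
  have hsign : Equiv.Perm.sign σ = ∏ i, Equiv.Perm.sign (τ i) := by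
    rw [hσ, Equiv.Perm.sign_mul, Equiv.Perm.sign_prodCongrLeft, Equiv.Perm.sign_prodCongrRight,
      Fin.prod_univ_two, Int.units_mul_self, one_mul]
  have hterm (i : Fin n) : stdSymplectic n K (σ (i, 0)) (σ (i, 1)) =
      ((Equiv.Perm.sign (τ i) : ℤ) : K) := by
    rw [stdSymplectic, if_pos (h i), ← hτ, ← hτ]
    simp only [τ]
    split_ifs <;> simp
  rw [Finset.prod_congr rfl fun i _ => hterm i, hsign, Units.coe_prod, Int.cast_prod,
    ← Finset.prod_mul_distrib]
  refine Finset.prod_eq_one fun i _ => ?_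
  rw [← Int.cast_mul, ← Units.val_mul, Int.units_mul_self]
  simp

/-- As all terms are `0` or `1`, no cancellation occurs: the sum counts the terms equal to `1`, the
identity permutation gives one of them, and in characteristic zero the count stays nonzero. -/
theorem pfaffianSum_stdSymplectic_ne_zero (n : ℕ) (K : Type*) [Field K] [CharZero K] :
    ∑ σ : Equiv.Perm (Fin n × Fin 2),
      ((Equiv.Perm.sign σ : ℤ) : K) * ∏ i, stdSymplectic n K (σ (i, 0)) (σ (i, 1)) ≠ 0 := by
  classical
  let t (σ : Equiv.Perm (Fin n × Fin 2)) : K :=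
    ((Equiv.Perm.sign σ : ℤ) : K) * ∏ i, stdSymplectic n K (σ (i, 0)) (σ (i, 1))
  have ht (σ) : t σ = if t σ = 1 then 1 else 0 := by
    rcases sign_mul_prod_stdSymplectic n K σ with h | h
    · simp [t, h]
    · simp [t, h]
  change ∑ σ, t σ ≠ 0
  rw [Finset.sum_congr rfl fun σ _ => ht σ, Finset.sum_boole, Nat.cast_ne_zero,
    Finset.card_ne_zero]
  exact ⟨1, by simp [t, stdSymplectic]⟩

end StandardForm

/-! ### Symplectic Gram–Schmidt -/

section SymplecticBasis

variable {K V : Type*} [Field K] [AddCommGroup V] [Module K V] [FiniteDimensional K V]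

/-- A family with the Gram matrix of the standard symplectic form can be enlarged by a
hyperbolic pair as long as it does not exhaust the dimension. -/
theorem exists_symplectic_family (B : LinearMap.BilinForm K V) (hB : B.IsAlt)
    (hnd : B.SeparatingLeft) (k : ℕ) (hk : 2 * k ≤ Module.finrank K V) :
    ∃ v : Fin k × Fin 2 → V, ∀ a b, B (v a) (v b) = stdSymplectic k K a b := by
  induction k with
  | zero => exact ⟨fun a => a.1.elim0, fun a => a.1.elim0⟩
  | succ k ih =>
    obtain ⟨v, hv⟩ := ih (by omega)
    have hneg (x y : V) : B x y = - B y x := (hB.neg_eq y x).symm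
    -- Orthogonality to the family imposes `2k` linear conditions in dimension at least `2k + 2`, so
    -- a nonzero solution exists.
    obtain ⟨x, hx, hx0⟩ := (Submodule.ne_bot_iff _).1 (LinearMap.ker_ne_bot_of_finrank_lt
      (f := LinearMap.pi fun a => B (v a)) (by simp; omega))
    have hx' (a) : B (v a) x = 0 := congrFun (LinearMap.mem_ker.1 hx) a
    obtain ⟨z, hz⟩ : ∃ z, B x z ≠ 0 := by
      by_contra! h
      exact hx0 (hnd x h)
    let z' : V := (B x z)⁻¹ • z
    have hz' : B x z' = 1 := by simp [z', hz]
    -- Subtracting the symplectic projection of `z'` onto the span of the family makes `y`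
    -- orthogonal to it; the pairing with `x` is unchanged because `x` is orthogonal to that span.
    let y : V := z' - ∑ i : Fin k, (B (v (i, 0)) z' • v (i, 1) - B (v (i, 1)) z' • v (i, 0))
    have hxv (a) : B x (v a) = 0 := by rw [hneg, hx', neg_zero]
    have hxy : B x y = 1 := by simp [y, hz', hxv]
    have hvy (a) : B (v a) y = 0 := by
      obtain ⟨j, a⟩ := a
      simp only [y, map_sub, map_sum, map_smul, hv, smul_eq_mul]
      rw [Finset.sum_eq_single j]
      · fin_cases a <;> simp [stdSymplectic]
      · intro i _ hi
        simp [stdSymplectic, hi.symm]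
      · simp
    have hyv (a) : B y (v a) = 0 := by rw [hneg, hvy, neg_zero]
    have hyx : B y x = -1 := by rw [hneg, hxy]
    refine ⟨fun a => Fin.cases (motive := fun _ => V) (![x, y] a.2) (fun i => v (i, a.2)) a.1, ?_⟩
    rintro ⟨i, a⟩ ⟨j, b⟩
    refine Fin.cases ?_ (fun i => ?_) i <;> refine Fin.cases ?_ (fun j => ?_) j
    · fin_cases a <;> fin_cases b <;>
        simp [stdSymplectic, hxy, hyx, hB.self_eq_zero x, hB.self_eq_zero y]
    · fin_cases a <;> simp [stdSymplectic, hxv, hyv, (Fin.succ_ne_zero j).symm]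
    · fin_cases b <;> simp [stdSymplectic, hx', hvy]
    · simp [stdSymplectic, hv]

end SymplecticBasis

/-! ### Powers of bivectors and the Pfaffian polynomial -/

section Bivector

variable {𝕜 : Type*} [RCLike 𝕜] {V : Type*} [AddCommGroup V] [Module 𝕜 V] [TopologicalSpace V]
  [IsTopologicalAddGroup V] [ContinuousSMul 𝕜 V]

theorem wedgePow_apply (n : ℕ) (P : (V →L[𝕜] 𝕜) [⋀^Fin 2]→L[𝕜] 𝕜)
    (v : Fin n × Fin 2 → V →L[𝕜] 𝕜) :
    wedgePow n P v = ((2 : 𝕜) ^ n)⁻¹ * ∑ σ : Equiv.Perm (Fin n × Fin 2),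
      ((Equiv.Perm.sign σ : ℤ) : 𝕜) * ∏ i, P ![v (σ (i, 0)), v (σ (i, 1))] := by
  rw [wedgePow, ContinuousAlternatingMap.smul_apply,
    ContinuousMultilinearMap.alternatization_apply_apply, smul_eq_mul]
  congr 1
  refine Finset.sum_congr rfl fun σ _ => ?_
  rw [Units.smul_def, zsmul_eq_mul]
  rfl

theorem wedgePow_neg (n : ℕ) (P : (V →L[𝕜] 𝕜) [⋀^Fin 2]→L[𝕜] 𝕜) :
    wedgePow n (-P) = (-1 : 𝕜) ^ n • wedgePow n P := by
  ext v
  rw [ContinuousAlternatingMap.smul_apply, wedgePow_apply, wedgePow_apply, smul_eq_mul,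
    mul_left_comm]
  congr 1
  rw [Finset.mul_sum]
  refine Finset.sum_congr rfl fun σ _ => ?_
  simp only [ContinuousAlternatingMap.neg_apply, Finset.prod_neg, Finset.card_univ,
    Fintype.card_fin]
  ring

/-- A bivector as a bilinear form on covectors. -/
def bivectorForm (P : (V →L[𝕜] 𝕜) [⋀^Fin 2]→L[𝕜] 𝕜) : LinearMap.BilinForm 𝕜 (V →L[𝕜] 𝕜) :=
  LinearMap.mk₂ 𝕜 (fun α β => P ![α, β]) (bivector_add_left P) (bivector_smul_left P)
    (bivector_add_right P) (bivector_smul_right P)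

theorem bivectorForm_apply (P : (V →L[𝕜] 𝕜) [⋀^Fin 2]→L[𝕜] 𝕜) (α β : V →L[𝕜] 𝕜) :
    bivectorForm P α β = P ![α, β] :=
  rfl

theorem bivectorForm_isAlt (P : (V →L[𝕜] 𝕜) [⋀^Fin 2]→L[𝕜] 𝕜) : (bivectorForm P).IsAlt :=
  fun α => P.map_eq_zero_of_eq ![α, α] (i := 0) (j := 1) rfl (by simp)

/-- The polynomial `c ↦ (c P₁ - P₂)ⁿ(v)`. -/
noncomputable def wedgePowPolynomial (n : ℕ) (P₁ P₂ : (V →L[𝕜] 𝕜) [⋀^Fin 2]→L[𝕜] 𝕜)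
    (v : Fin n × Fin 2 → V →L[𝕜] 𝕜) : 𝕜[X] :=
  C ((2 : 𝕜) ^ n)⁻¹ * ∑ σ : Equiv.Perm (Fin n × Fin 2),
    C ((Equiv.Perm.sign σ : ℤ) : 𝕜) * ∏ i, (C (P₁ ![v (σ (i, 0)), v (σ (i, 1))]) * X +
      C (-P₂ ![v (σ (i, 0)), v (σ (i, 1))]))

theorem eval_wedgePowPolynomial (n : ℕ) (P₁ P₂ : (V →L[𝕜] 𝕜) [⋀^Fin 2]→L[𝕜] 𝕜)
    (v : Fin n × Fin 2 → V →L[𝕜] 𝕜) (c : 𝕜) :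
    (wedgePowPolynomial n P₁ P₂ v).eval c = wedgePow n (c • P₁ - P₂) v := by
  rw [wedgePow_apply, wedgePowPolynomial, eval_C_mul, eval_finsetSum]
  congr 1
  refine Finset.sum_congr rfl fun σ _ => ?_
  rw [eval_C_mul, eval_prod]
  congr 1
  refine Finset.prod_congr rfl fun i _ => ?_
  simp only [eval_add, eval_mul, eval_C, eval_X, ContinuousAlternatingMap.sub_apply,
    ContinuousAlternatingMap.smul_apply, smul_eq_mul]
  ring

theorem natDegree_wedgePowPolynomial_le (n : ℕ) (P₁ P₂ : (V →L[𝕜] 𝕜) [⋀^Fin 2]→L[𝕜] 𝕜)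
    (v : Fin n × Fin 2 → V →L[𝕜] 𝕜) : (wedgePowPolynomial n P₁ P₂ v).natDegree ≤ n := by
  refine (natDegree_C_mul_le _ _).trans (natDegree_sum_le_of_forall_le _ _ fun σ _ => ?_)
  refine (natDegree_C_mul_le _ _).trans ((natDegree_prod_le _ _).trans ?_)
  refine (Finset.sum_le_sum fun i _ => natDegree_linear_le).trans ?_
  simp

/-- Each product has `n` factors of degree at most one, so its coefficient in degree `n` is the
product of the linear coefficients, which involve `P₁` alone. This is what makes the polynomial
monic after division by `P₁ⁿ`. -/
theorem coeff_wedgePowPolynomial (n : ℕ) (P₁ P₂ : (V →L[𝕜] 𝕜) [⋀^Fin 2]→L[𝕜] 𝕜)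
    (v : Fin n × Fin 2 → V →L[𝕜] 𝕜) :
    (wedgePowPolynomial n P₁ P₂ v).coeff n = wedgePow n P₁ v := by
  rw [wedgePow_apply, wedgePowPolynomial, coeff_C_mul, finsetSum_coeff]
  congr 1
  refine Finset.sum_congr rfl fun σ _ => ?_
  rw [coeff_C_mul]
  congr 1
  have h := coeff_prod_of_natDegree_le Finset.univ (fun i : Fin n =>
    C (P₁ ![v (σ (i, 0)), v (σ (i, 1))]) * X + C (-P₂ ![v (σ (i, 0)), v (σ (i, 1))])) 1
    fun i _ => natDegree_linear_le
  rw [Finset.card_univ, Fintype.card_fin, mul_one] at h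
  rw [h]
  refine Finset.prod_congr rfl fun i _ => ?_
  simp

variable [T2Space V] [FiniteDimensional 𝕜 V]

instance finiteDimensional_dual : FiniteDimensional 𝕜 (V →L[𝕜] 𝕜) :=
  Module.Finite.equiv (LinearMap.toContinuousLinearMap (𝕜 := 𝕜) (E := V) (F' := 𝕜))

theorem finrank_dual : Module.finrank 𝕜 (V →L[𝕜] 𝕜) = Module.finrank 𝕜 V := by
  rw [← (LinearMap.toContinuousLinearMap (𝕜 := 𝕜) (E := V) (F' := 𝕜)).finrank_eq]
  exact Subspace.dual_finrank_eq

theorem bivectorForm_eq_apply_sharp (P : (V →L[𝕜] 𝕜) [⋀^Fin 2]→L[𝕜] 𝕜) (α β : V →L[𝕜] 𝕜) :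
    bivectorForm P α β = β (sharp P α) :=
  (apply_sharp P α β).symm

theorem ext_of_forall_apply {x y : V} (h : ∀ β : V →L[𝕜] 𝕜, β x = β y) : x = y := by
  refine (Module.evalEquiv 𝕜 V).injective (LinearMap.ext fun β => ?_)
  exact h (LinearMap.toContinuousLinearMap β)

theorem bivectorForm_separatingLeft {P : (V →L[𝕜] 𝕜) [⋀^Fin 2]→L[𝕜] 𝕜}
    (hP : Function.Injective (sharp P)) : (bivectorForm P).SeparatingLeft := fun α hα =>
  (injective_iff_map_eq_zero _).1 hP α <| ext_of_forall_apply (𝕜 := 𝕜) fun β => by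
    rw [← bivectorForm_eq_apply_sharp, hα, map_zero]

theorem sharp_sub_smul (P₁ P₂ : (V →L[𝕜] 𝕜) [⋀^Fin 2]→L[𝕜] 𝕜) (c : 𝕜) :
    sharp (c • P₁ - P₂) = c • sharp P₁ - sharp P₂ := by
  ext1 α
  refine ext_of_forall_apply (𝕜 := 𝕜) fun β => ?_
  simp [apply_sharp]

theorem exists_basis_dual {n : ℕ} (hV : Module.finrank 𝕜 V = 2 * n) :
    Nonempty (Module.Basis (Fin n × Fin 2) 𝕜 (V →L[𝕜] 𝕜)) :=
  ⟨(Module.finBasisOfFinrankEq 𝕜 (V →L[𝕜] 𝕜) (finrank_dual.trans (hV.trans (mul_comm 2 n)))).reindex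
    finProdFinEquiv.symm⟩

/-- The value of `Pⁿ` on a family of covectors in which `P` is the standard symplectic form. -/
noncomputable def stdPfaffian (n : ℕ) (𝕜 : Type*) [RCLike 𝕜] : 𝕜 :=
  ((2 : 𝕜) ^ n)⁻¹ * ∑ σ : Equiv.Perm (Fin n × Fin 2),
    ((Equiv.Perm.sign σ : ℤ) : 𝕜) * ∏ i, stdSymplectic n 𝕜 (σ (i, 0)) (σ (i, 1))

theorem stdPfaffian_ne_zero (n : ℕ) (𝕜 : Type*) [RCLike 𝕜] : stdPfaffian n 𝕜 ≠ 0 :=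
  mul_ne_zero (inv_ne_zero (pow_ne_zero _ two_ne_zero)) (pfaffianSum_stdSymplectic_ne_zero n 𝕜)

/-- The square of the Pfaffian is the determinant, up to normalisation. -/
theorem wedgePow_sq_mul {n : ℕ} (e : Module.Basis (Fin n × Fin 2) 𝕜 (V →L[𝕜] 𝕜))
    {P : (V →L[𝕜] 𝕜) [⋀^Fin 2]→L[𝕜] 𝕜} (hP : Function.Injective (sharp P)) :
    wedgePow n P e ^ 2 * (stdSymplectic n 𝕜).det =
      stdPfaffian n 𝕜 ^ 2 * (LinearMap.BilinForm.toMatrix e (bivectorForm P)).det := by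
  obtain ⟨v, hv⟩ := exists_symplectic_family (bivectorForm P) (bivectorForm_isAlt P)
    (bivectorForm_separatingLeft hP) n (by
      rw [Module.finrank_eq_card_basis e]; simp [mul_comm])
  -- Both invariants are compared along the map from `e` to the symplectic family: the Gram
  -- determinant scales by `(det T)²` and the top-degree form by `det T`.
  let T : (V →L[𝕜] 𝕜) →ₗ[𝕜] (V →L[𝕜] 𝕜) := e.constr 𝕜 v
  have hT (a) : T (e a) = v a := e.constr_basis 𝕜 v a
  have hgram : LinearMap.BilinForm.toMatrix e ((bivectorForm P).comp T T) =
      stdSymplectic n 𝕜 := by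
    ext a b
    rw [LinearMap.BilinForm.toMatrix_apply, LinearMap.BilinForm.comp_apply, hT, hT, hv]
  have hdet : (stdSymplectic n 𝕜).det =
      LinearMap.det T ^ 2 * (LinearMap.BilinForm.toMatrix e (bivectorForm P)).det := by
    rw [← hgram, LinearMap.BilinForm.toMatrix_comp e e, Matrix.det_mul, Matrix.det_mul,
      Matrix.det_transpose, LinearMap.det_toMatrix]
    ring
  have hpf : stdPfaffian n 𝕜 = wedgePow n P e * LinearMap.det T := by
    have h1 : wedgePow n P v = stdPfaffian n 𝕜 := by
      rw [wedgePow_apply, stdPfaffian]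
      simp only [← bivectorForm_apply, hv]
    have h2 := congrArg (fun f => f v)
      (AlternatingMap.eq_smul_basis_det e (wedgePow n P).toAlternatingMap)
    have h3 : v = T ∘ e := funext fun a => (hT a).symm
    have h4 : e.det v = LinearMap.det T := by
      rw [h3, Module.Basis.det_comp, Module.Basis.det_self, mul_one]
    rw [← h1, ← h4]
    exact h2
  rw [hdet, hpf]
  ring

theorem det_toMatrix_bivectorForm_ne_zero {n : ℕ}
    (e : Module.Basis (Fin n × Fin 2) 𝕜 (V →L[𝕜] 𝕜))
    {P : (V →L[𝕜] 𝕜) [⋀^Fin 2]→L[𝕜] 𝕜} (hP : Function.Injective (sharp P)) :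
    (LinearMap.BilinForm.toMatrix e (bivectorForm P)).det ≠ 0 :=
  (LinearMap.BilinForm.nondegenerate_iff_det_ne_zero e).1
    (.ofSeparatingLeft (bivectorForm_separatingLeft hP))

theorem wedgePow_basis_ne_zero {n : ℕ} (e : Module.Basis (Fin n × Fin 2) 𝕜 (V →L[𝕜] 𝕜))
    {P : (V →L[𝕜] 𝕜) [⋀^Fin 2]→L[𝕜] 𝕜} (hP : Function.Injective (sharp P)) :
    wedgePow n P e ≠ 0 := fun h => by
  have h' := wedgePow_sq_mul e hP
  rw [h, zero_pow two_ne_zero, zero_mul] at h'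
  exact mul_ne_zero (pow_ne_zero _ (stdPfaffian_ne_zero n 𝕜))
    (det_toMatrix_bivectorForm_ne_zero e hP) h'.symm

/-- The form of `c P₁ - P₂` is that of `P₁` with its first argument composed with `c - T`, where `T
= S⁻¹ ∘ ♯_{P₂}` is the conjugate by `S` of the recursion operator. The determinant of `c - T` is
thus the characteristic polynomial at `c`. -/
theorem det_toMatrix_sub_smul {n : ℕ} (e : Module.Basis (Fin n × Fin 2) 𝕜 (V →L[𝕜] 𝕜))
    (P₁ P₂ : (V →L[𝕜] 𝕜) [⋀^Fin 2]→L[𝕜] 𝕜) (S : (V →L[𝕜] 𝕜) ≃ₗ[𝕜] V)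
    (hS : S.toLinearMap = sharp P₁) (c : 𝕜) :
    (LinearMap.BilinForm.toMatrix e (bivectorForm (c • P₁ - P₂))).det =
      (sharp P₂ ∘ₗ S.symm.toLinearMap).charpoly.eval c *
        (LinearMap.BilinForm.toMatrix e (bivectorForm P₁)).det := by
  let T : (V →L[𝕜] 𝕜) →ₗ[𝕜] (V →L[𝕜] 𝕜) := S.symm.conj (sharp P₂ ∘ₗ S.symm.toLinearMap)
  have hST (α) : S (T α) = sharp P₂ α := by simp [T, LinearEquiv.conj_apply]
  have hform : bivectorForm (c • P₁ - P₂) =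
      (bivectorForm P₁).compLeft (algebraMap 𝕜 (Module.End 𝕜 (V →L[𝕜] 𝕜)) c - T) := by
    refine LinearMap.ext₂ fun α β => ?_
    rw [LinearMap.BilinForm.compLeft_apply, bivectorForm_eq_apply_sharp,
      bivectorForm_eq_apply_sharp, sharp_sub_smul, ← hS]
    simp [hST]
  rw [hform, LinearMap.BilinForm.toMatrix_compLeft, Matrix.det_mul, Matrix.det_transpose,
    LinearMap.det_toMatrix, ← LinearEquiv.charpoly_conj S.symm, LinearMap.eval_charpoly]

/-- The Pfaffian polynomial of the recursion operator is `c ↦ (c P₁ - P₂)ⁿ / P₁ⁿ`. -/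
theorem pfaffianPolynomial_recursion {n : ℕ}
    (e : Module.Basis (Fin n × Fin 2) 𝕜 (V →L[𝕜] 𝕜))
    (P₁ P₂ : (V →L[𝕜] 𝕜) [⋀^Fin 2]→L[𝕜] 𝕜) (S : (V →L[𝕜] 𝕜) ≃ₗ[𝕜] V)
    (hS : S.toLinearMap = sharp P₁) :
    pfaffianPolynomial (sharp P₂ ∘ₗ S.symm.toLinearMap) =
        C (wedgePow n P₁ e)⁻¹ * wedgePowPolynomial n P₁ P₂ e ∧
      (C (wedgePow n P₁ e)⁻¹ * wedgePowPolynomial n P₁ P₂ e).Monic := by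
  have hinj : Function.Injective (sharp P₁) := by
    rw [← hS]; exact S.injective
  have hF := wedgePow_basis_ne_zero e hinj
  have hmonic : (C (wedgePow n P₁ e)⁻¹ * wedgePowPolynomial n P₁ P₂ e).Monic := by
    refine monic_of_natDegree_le_of_coeff_eq_one n
      ((natDegree_C_mul_le _ _).trans (natDegree_wedgePowPolynomial_le n P₁ P₂ e)) ?_
    rw [coeff_C_mul, coeff_wedgePowPolynomial, inv_mul_cancel₀ hF]
  refine ⟨pfaffianPolynomial_eq _ _ hmonic ?_, hmonic⟩
  set χ := (sharp P₂ ∘ₗ S.symm.toLinearMap).charpoly with hχ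
  have hχ0 : χ ≠ 0 := (LinearMap.charpoly_monic _).ne_zero
  -- `wedgePow_sq_mul` needs nondegeneracy, which holds for `c P₁ - P₂` away from the finitely many
  -- roots of `χ`; agreement at all other `c` suffices over an infinite field.
  refine eq_of_infinite_eval_eq _ _ (((finite_setOfPred_isRoot hχ0).infinite_compl).mono ?_)
  intro c hc
  have hdet := det_toMatrix_sub_smul e P₁ P₂ S hS c
  have hinjc : Function.Injective (sharp (c • P₁ - P₂)) := by
    refine (injective_iff_map_eq_zero _).2 fun α hα => ?_
    have hne : (LinearMap.BilinForm.toMatrix e (bivectorForm (c • P₁ - P₂))).det ≠ 0 := by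
      rw [hdet]
      exact mul_ne_zero hc (det_toMatrix_bivectorForm_ne_zero e hinj)
    refine ((LinearMap.BilinForm.nondegenerate_iff_det_ne_zero e).2 hne).1 α fun β => ?_
    rw [bivectorForm_eq_apply_sharp, hα, map_zero]
  have h1 := wedgePow_sq_mul e hinj
  have h2 := wedgePow_sq_mul e hinjc
  rw [hdet, mul_left_comm, ← h1, ← hχ] at h2
  have h3 : wedgePow n (c • P₁ - P₂) e ^ 2 = eval c χ * wedgePow n P₁ e ^ 2 :=
    mul_right_cancel₀ (det_stdSymplectic_ne_zero n 𝕜) (by rw [h2]; ring)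
  rw [Set.mem_ofPred_eq, eval_pow, eval_C_mul, eval_wedgePowPolynomial, mul_pow, h3, inv_pow]
  field_simp

theorem pfaffianPolynomial_recursion_monic {n : ℕ} (hV : Module.finrank 𝕜 V = 2 * n)
    (P₁ P₂ : (V →L[𝕜] 𝕜) [⋀^Fin 2]→L[𝕜] 𝕜) (S : (V →L[𝕜] 𝕜) ≃ₗ[𝕜] V)
    (hS : S.toLinearMap = sharp P₁) :
    (pfaffianPolynomial (sharp P₂ ∘ₗ S.symm.toLinearMap)).Monic ∧
      (pfaffianPolynomial (sharp P₂ ∘ₗ S.symm.toLinearMap)).natDegree = n := by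
  obtain ⟨e⟩ := exists_basis_dual hV
  obtain ⟨h, hm⟩ := pfaffianPolynomial_recursion e P₁ P₂ S hS
  rw [h]
  refine ⟨hm, le_antisymm
    ((natDegree_C_mul_le _ _).trans (natDegree_wedgePowPolynomial_le n P₁ P₂ e)) ?_⟩
  refine le_natDegree_of_ne_zero ?_
  rw [coeff_C_mul, coeff_wedgePowPolynomial, inv_mul_cancel₀]
  · exact one_ne_zero
  · exact wedgePow_basis_ne_zero e (by rw [← hS]; exact S.injective)

/-- Two top-degree multivectors which agree on a basis of covectors are equal. -/
theorem top_multivector_eq {ι : Type*} [Finite ι] (e : Module.Basis ι 𝕜 (V →L[𝕜] 𝕜))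
    {f g : (V →L[𝕜] 𝕜) [⋀^ι]→L[𝕜] 𝕜} (h : f e = g e) : f = g :=
  ContinuousAlternatingMap.toAlternatingMap_injective <| by
    rw [← sub_eq_zero, ← AlternatingMap.map_basis_eq_zero_iff e]
    exact sub_eq_zero.2 h

/-- The sign arises from `P₂ - c P₁ = -(c P₁ - P₂)`. A top-degree multivector is determined by one
value on a basis, and there the formula for the Pfaffian polynomial applies. -/
theorem wedgePow_sub_smul {n : ℕ} (hV : Module.finrank 𝕜 V = 2 * n)
    (P₁ P₂ : (V →L[𝕜] 𝕜) [⋀^Fin 2]→L[𝕜] 𝕜) (S : (V →L[𝕜] 𝕜) ≃ₗ[𝕜] V)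
    (hS : S.toLinearMap = sharp P₁) (c : 𝕜) :
    wedgePow n (P₂ - c • P₁) =
      ((-1) ^ n * (pfaffianPolynomial (sharp P₂ ∘ₗ S.symm.toLinearMap)).eval c) •
        wedgePow n P₁ := by
  obtain ⟨e⟩ := exists_basis_dual hV
  have hF := wedgePow_basis_ne_zero e (P := P₁) (by rw [← hS]; exact S.injective)
  have hneg : P₂ - c • P₁ = -(c • P₁ - P₂) := by ext; simp
  rw [hneg, wedgePow_neg, mul_smul]
  congr 1
  refine top_multivector_eq e ?_
  rw [(pfaffianPolynomial_recursion e P₁ P₂ S hS).1, eval_C_mul, eval_wedgePowPolynomial,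
    ContinuousAlternatingMap.smul_apply, smul_eq_mul]
  field_simp

theorem wedgePow_ne_zero {n : ℕ} (hV : Module.finrank 𝕜 V = 2 * n)
    {P : (V →L[𝕜] 𝕜) [⋀^Fin 2]→L[𝕜] 𝕜} (hP : Function.Injective (sharp P)) :
    wedgePow n P ≠ 0 := fun h => by
  obtain ⟨e⟩ := exists_basis_dual hV
  exact wedgePow_basis_ne_zero e hP (by rw [h]; rfl)

/-- The space of top-degree multivectors is spanned by each of its nonzero elements. -/
theorem exists_smul_eq_of_top_multivector {n : ℕ} (hV : Module.finrank 𝕜 V = 2 * n)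
    {f : (V →L[𝕜] 𝕜) [⋀^Fin n × Fin 2]→L[𝕜] 𝕜} (hf : f ≠ 0)
    (g : (V →L[𝕜] 𝕜) [⋀^Fin n × Fin 2]→L[𝕜] 𝕜) : ∃ k : 𝕜, g = k • f := by
  obtain ⟨e⟩ := exists_basis_dual hV
  have hfe : f e ≠ 0 := fun h => hf (top_multivector_eq e h)
  refine ⟨g e / f e, top_multivector_eq e ?_⟩
  rw [ContinuousAlternatingMap.smul_apply, smul_eq_mul, div_mul_cancel₀ _ hfe]

end Bivector

end BiPoisson

/-! ### Differentials of sections of a fibre bundle -/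

section FiberBundle

variable {𝕜 : Type*} [NontriviallyNormedField 𝕜] {EB : Type*} [NormedAddCommGroup EB]
  [NormedSpace 𝕜 EB] {F : Type*} [NormedAddCommGroup F] [NormedSpace 𝕜 F]
  {B : Type*} [TopologicalSpace B] [ChartedSpace EB B]
  {Z : B → Type*} [TopologicalSpace (TotalSpace F Z)] [∀ b, TopologicalSpace (Z b)]
  [FiberBundle F Z]

/-- The differential of a section of a fibre bundle, in the preferred trivialization. -/
theorem hasMFDerivAt_section (s : ∀ b, Z b) (b₀ : B) (L : EB →L[𝕜] F)
    (h : HasMFDerivAt 𝓘(𝕜, EB) 𝓘(𝕜, F) (fun b => (trivializationAt F Z b₀ ⟨b, s b⟩).2) b₀ L) :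
    HasMFDerivAt 𝓘(𝕜, EB) (𝓘(𝕜, EB).prod 𝓘(𝕜, F)) (fun b => (⟨b, s b⟩ : TotalSpace F Z)) b₀
      ((ContinuousLinearMap.id 𝕜 EB).prod L) := by
  refine ⟨(FiberBundle.continuousAt_totalSpace F _).2 ⟨continuousAt_id, h.1⟩, ?_⟩
  have h2 : HasFDerivWithinAt (writtenInExtChartAt 𝓘(𝕜, EB) 𝓘(𝕜, F) b₀
      (fun b => (trivializationAt F Z b₀ ⟨b, s b⟩).2)) L (Set.range 𝓘(𝕜, EB))
      (extChartAt 𝓘(𝕜, EB) b₀ b₀) := h.2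
  refine ((hasFDerivWithinAt_id (𝕜 := 𝕜) _ _).prodMk h2).congr_of_eventuallyEq ?_ ?_
  -- Near the base point the inverse chart is a true inverse and lands in the domain of the
  -- trivialization; there the base component of the section in coordinates is the identity.
  · have h3 : ∀ᶠ u in 𝓝 (extChartAt 𝓘(𝕜, EB) b₀ b₀),
        (extChartAt 𝓘(𝕜, EB) b₀).symm u ∈ (trivializationAt F Z b₀).baseSet := by
      refine (continuousAt_extChartAt_symm b₀).eventually_mem ?_
      rw [extChartAt_to_inv]
      exact (trivializationAt F Z b₀).open_baseSet.mem_nhds (mem_baseSet_trivializationAt F Z b₀)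
    have h4 : ∀ᶠ u in 𝓝 (extChartAt 𝓘(𝕜, EB) b₀ b₀), u ∈ (extChartAt 𝓘(𝕜, EB) b₀).target :=
      extChartAt_target_mem_nhds b₀
    refine Filter.Eventually.filter_mono nhdsWithin_le_nhds ?_
    filter_upwards [h3, h4] with u hu hu'
    simp only [writtenInExtChartAt, FiberBundle.extChartAt, Function.comp_apply,
      PartialEquiv.trans_apply, PartialEquiv.prod_coe, PartialEquiv.refl_coe,
      OpenPartialHomeomorph.coe_toPartialEquiv, Trivialization.coe_coe]
    rw [Trivialization.coe_fst' _ hu, PartialEquiv.right_inv _ hu']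
    rfl
  · simp only [writtenInExtChartAt, FiberBundle.extChartAt, Function.comp_apply,
      PartialEquiv.trans_apply, PartialEquiv.prod_coe, PartialEquiv.refl_coe,
      OpenPartialHomeomorph.coe_toPartialEquiv, Trivialization.coe_coe]
    rw [extChartAt_to_inv, Trivialization.coe_fst' _ (mem_baseSet_trivializationAt F Z b₀)]
    rfl

end FiberBundle

/-! ### Submersions in normal form -/

section Submersion

variable {𝕜 : Type*} [NontriviallyNormedField 𝕜] {E : Type*} [NormedAddCommGroup E]
  [NormedSpace 𝕜 E] {E' : Type*} [NormedAddCommGroup E'] [NormedSpace 𝕜 E']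
  {M : Type*} [TopologicalSpace M] [ChartedSpace E M]
  {N : Type*} [TopologicalSpace N] [ChartedSpace E' N]

/-- The differential of a submersion is surjective. -/
theorem mfderiv_surjective_of_isSubmersionAt {n : WithTop ℕ∞} (hn : 1 ≤ n) {f : M → N} {x : M}
    (h : Manifold.IsSubmersionAt 𝓘(𝕜, E) 𝓘(𝕜, E') n f x) :
    Function.Surjective (mfderiv 𝓘(𝕜, E) 𝓘(𝕜, E') f x) := by
  obtain ⟨F, _, _, hF⟩ := h
  have hn0 : n ≠ 0 := by
    rintro rfl
    simp at hn
  have hdom := hF.mem_domChart_source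
  have hcod := hF.mem_codChart_source
  let q : E := hF.domChart x
  -- In the charts of the normal form `f` is the projection to the first factor. Freezing the second
  -- coordinate at that of `x` yields a local right inverse `g` of `f` through `x`; the chain rule
  -- for `f ∘ g` then gives surjectivity.
  let r (y : N) : E := hF.equiv.symm (hF.codChart y, (hF.equiv q).2)
  let g (y : N) : M := hF.domChart.symm (r y)
  have hwr (u : E) (hu : u ∈ hF.domChart.target) :
      hF.codChart (f (hF.domChart.symm u)) = (hF.equiv u).1 := by
    have := hF.writtenInCharts (show u ∈ (hF.domChart.extend 𝓘(𝕜, E)).target by simpa using hu)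
    simpa using this
  have hrx : r (f x) = q := by
    have := hwr q (hF.domChart.map_source hdom)
    rw [hF.domChart.left_inv hdom] at this
    simp only [r, this, Prod.mk.eta]
    exact hF.equiv.symm_apply_apply q
  have hcodd : MDifferentiableAt 𝓘(𝕜, E') 𝓘(𝕜, E') hF.codChart (f x) :=
    ((contMDiffOn_of_mem_maximalAtlas hF.codChart_mem_maximalAtlas).contMDiffAt
      (hF.codChart.open_source.mem_nhds hcod)).mdifferentiableAt hn0
  have hrd : MDifferentiableAt 𝓘(𝕜, E') 𝓘(𝕜, E) r (f x) := by
    have hlin : MDifferentiableAt 𝓘(𝕜, E') 𝓘(𝕜, E)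
        (fun z : E' => hF.equiv.symm (z, (hF.equiv q).2)) (hF.codChart (f x)) := by
      rw [mdifferentiableAt_iff_differentiableAt]
      fun_prop
    exact hlin.comp (f x) hcodd
  have htgt : r (f x) ∈ hF.domChart.target := hrx ▸ hF.domChart.map_source hdom
  have hgd : MDifferentiableAt 𝓘(𝕜, E') 𝓘(𝕜, E) g (f x) :=
    (((contMDiffOn_symm_of_mem_maximalAtlas hF.domChart_mem_maximalAtlas).contMDiffAt
      (hF.domChart.open_target.mem_nhds htgt)).mdifferentiableAt hn0).comp (f x) hrd
  have hgx : g (f x) = x := by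
    simp only [g, hrx]
    exact hF.domChart.left_inv hdom
  have hfd : MDifferentiableAt 𝓘(𝕜, E) 𝓘(𝕜, E') f x := hF.contMDiffAt.mdifferentiableAt hn0
  have hfg : f ∘ g =ᶠ[𝓝 (f x)] id := by
    have h1 : ∀ᶠ y in 𝓝 (f x), r y ∈ hF.domChart.target :=
      hrd.continuousAt.eventually_mem (hF.domChart.open_target.mem_nhds htgt)
    filter_upwards [h1, hF.codChart.open_source.mem_nhds hcod] with y hy hy'
    refine hF.codChart.injOn ?_ hy' ?_
    · exact hF.source_subset_preimage_source (hF.domChart.map_target hy)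
    · rw [Function.comp_apply, hwr _ hy]
      simp [r]
  have hcomp : HasMFDerivAt 𝓘(𝕜, E') 𝓘(𝕜, E') (f ∘ g) (f x)
      ((mfderiv 𝓘(𝕜, E) 𝓘(𝕜, E') f (g (f x))).comp (mfderiv 𝓘(𝕜, E') 𝓘(𝕜, E) g (f x))) :=
    HasMFDerivAt.comp (f x) (by rw [hgx]; exact hfd.hasMFDerivAt) hgd.hasMFDerivAt
  have hid := (hasMFDerivAt_id (I := 𝓘(𝕜, E')) (f x)).congr_of_eventuallyEq hfg
  have huniq := hasMFDerivAt_unique hcomp hid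
  intro v
  rw [hgx] at huniq
  exact ⟨mfderiv 𝓘(𝕜, E') 𝓘(𝕜, E) g (f x) v, congrArg (fun T => T v) huniq⟩

end Submersion

/-! ### Differential calculus and transversality in a product -/

section Calculus

variable {𝕜 : Type*} [NontriviallyNormedField 𝕜] {E : Type*} [NormedAddCommGroup E]
  [NormedSpace 𝕜 E] {F : Type*} [NormedAddCommGroup F] [NormedSpace 𝕜 F]
  {M : Type*} [TopologicalSpace M] [ChartedSpace E M]

theorem hasMFDerivAt_smul_const {u : M → 𝕜} {m : M} {du : E →L[𝕜] 𝕜}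
    (h : HasMFDerivAt 𝓘(𝕜, E) 𝓘(𝕜, 𝕜) u m du) (f : F) :
    HasMFDerivAt 𝓘(𝕜, E) 𝓘(𝕜, F) (fun x => u x • f) m (du.smulRight f) := by
  have h1 : HasFDerivAt (fun t : 𝕜 => t • f)
      ((ContinuousLinearMap.id 𝕜 𝕜).smulRight f) (u m) :=
    (hasFDerivAt_id (𝕜 := 𝕜) (u m)).smul_const f
  exact h1.hasMFDerivAt.comp m h

theorem hasMFDerivAt_mul_of_eq_zero {u k : M → 𝕜} {m : M} {du : E →L[𝕜] 𝕜}
    (hu : HasMFDerivAt 𝓘(𝕜, E) 𝓘(𝕜, 𝕜) u m du) (h0 : u m = 0)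
    (hk : MDifferentiableAt 𝓘(𝕜, E) 𝓘(𝕜, 𝕜) k m) :
    HasMFDerivAt 𝓘(𝕜, E) 𝓘(𝕜, 𝕜) (fun x => u x * k x) m (k m • du) := by
  let dk : E →L[𝕜] 𝕜 := mfderiv 𝓘(𝕜, E) 𝓘(𝕜, 𝕜) k m
  have h : HasMFDerivAt 𝓘(𝕜, E) 𝓘(𝕜, 𝕜) (fun x => u x * k x) m (u m • dk + k m • du) :=
    hu.mul hk.hasMFDerivAt
  have e : u m • dk + k m • du = k m • du := by
    ext v
    simp [h0]
  exact e ▸ h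

theorem contMDiffAt_const_mul_sum_prod {ι κ : Type*} [Fintype ι] [Fintype κ] {n : WithTop ℕ∞}
    (c : 𝕜) (a : ι → 𝕜) (f : ι → κ → M → 𝕜) (m : M)
    (hf : ∀ i k, ContMDiffAt 𝓘(𝕜, E) 𝓘(𝕜, 𝕜) n (f i k) m) :
    ContMDiffAt 𝓘(𝕜, E) 𝓘(𝕜, 𝕜) n (fun x => c * ∑ i, a i * ∏ k, f i k x) m := by
  have h1 : ContMDiffAt 𝓘(𝕜, E) 𝓘(𝕜, ι → κ → 𝕜) n (fun x i k => f i k x) m :=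
    contMDiffAt_pi_space.2 fun i => contMDiffAt_pi_space.2 fun k => hf i k
  have h2 : ContDiff 𝕜 n fun y : ι → κ → 𝕜 => c * ∑ i, a i * ∏ k, y i k :=
    contDiff_const.mul <| ContDiff.sum fun i _ => contDiff_const.mul <| contDiff_prod fun k _ =>
      contDiff_apply_apply 𝕜 𝕜 i k
  exact h2.contMDiff.contMDiffAt.comp m h1

/-- The zero section supplies all horizontal vectors. Since `L` is nonzero, the graph supplies a
vector with any prescribed multiple of `f` as vertical part, and `f` spans the fibre. -/
theorem range_prod_sup_range_prod_zero (f : F) (hf : ∀ g, ∃ k : 𝕜, g = k • f) {L : E →L[𝕜] 𝕜}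
    (hL : L ≠ 0) :
    LinearMap.range ((ContinuousLinearMap.id 𝕜 E).prod (L.smulRight f)).toLinearMap ⊔
      LinearMap.range ((ContinuousLinearMap.id 𝕜 E).prod (0 : E →L[𝕜] F)).toLinearMap = ⊤ := by
  rw [eq_top_iff]
  rintro ⟨a, b⟩ -
  obtain ⟨k, rfl⟩ := hf b
  obtain ⟨w, hw⟩ : ∃ w, L w ≠ 0 := by
    by_contra! h
    exact hL (ContinuousLinearMap.ext h)
  refine Submodule.mem_sup.2 ⟨((k / L w) • w, k • f), ⟨(k / L w) • w, ?_⟩,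
    (a - (k / L w) • w, 0), ⟨a - (k / L w) • w, ?_⟩, ?_⟩
  · simp [smul_smul, hw]
  · simp
  · simp

end Calculus

namespace BiPoisson

/-! ### Multivector fields in a trivialization -/

section Manifold

variable {𝕜 : Type*} [RCLike 𝕜] {E : Type*} [NormedAddCommGroup E] [NormedSpace 𝕜 E]
  {M : Type*} [TopologicalSpace M] [ChartedSpace E M] [IsManifold 𝓘(𝕜, E) ∞ M]

/-- The covector at `x` corresponding to a covector of the model space under the preferred
trivialization of `T^*M` at `m`. -/
noncomputable def covectorAt (m x : M) :
    (E →L[𝕜] 𝕜) →L[𝕜] (TangentSpace 𝓘(𝕜, E) x →L[𝕜] 𝕜) :=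
  (trivializationAt (E →L[𝕜] 𝕜)
    (fun x : M => TangentSpace 𝓘(𝕜, E) x →L[𝕜] Trivial M 𝕜 x) m).symmL 𝕜 x

theorem covectorAt_self_surjective (m : M) :
    Function.Surjective (covectorAt (𝕜 := 𝕜) (E := E) m m) := by
  intro α
  let t := trivializationAt (E →L[𝕜] 𝕜)
    (fun x : M => TangentSpace 𝓘(𝕜, E) x →L[𝕜] Trivial M 𝕜 x) m
  have hm : m ∈ t.baseSet := mem_baseSet_trivializationAt (E →L[𝕜] 𝕜)
    (fun x : M => TangentSpace 𝓘(𝕜, E) x →L[𝕜] Trivial M 𝕜 x) m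
  exact ⟨t.continuousLinearMapAt 𝕜 m α, t.symmL_continuousLinearMapAt (R := 𝕜) hm α⟩

/-- A section of `Λ^ι TM` in the preferred trivialization at `m`. -/
noncomputable def inTriv {ι : Type*} [Fintype ι] (s : MultivectorField 𝕜 (E := E) M ι)
    (m x : M) : MultivectorModel 𝕜 E ι :=
  (trivializationAt (MultivectorModel 𝕜 E ι) (Multivector 𝕜 (E := E) (M := M) ι) m
    (toTotal s x)).2

/-- Trivializing a bundle of alternating forms amounts to pulling back along the inverse
trivialization of the bundle of arguments, here `T^*M`. Pointwise identities between multivectors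
thereby pass to the trivialization. -/
theorem inTriv_apply {ι : Type*} [Fintype ι] (s : MultivectorField 𝕜 (E := E) M ι) (m x : M)
    (v : ι → E →L[𝕜] 𝕜) : inTriv s m x v = s x (fun i => covectorAt m x (v i)) := by
  rw [inTriv, toTotal, FiberBundle.trivializationAt_continuousAlternatingMap_apply]
  simp [ContinuousAlternatingMap.inCoordinates]
  rfl

theorem inTriv_self_ne_zero {ι : Type*} [Fintype ι] {s : MultivectorField 𝕜 (E := E) M ι} {m : M}
    (h : s m ≠ 0) : inTriv s m m ≠ 0 := fun h0 => h <| by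
  ext v
  choose w hw using fun i => covectorAt_self_surjective (𝕜 := 𝕜) (E := E) m (v i)
  have h1 := inTriv_apply s m m w
  rw [h0] at h1
  simp only [hw] at h1
  exact h1.symm

/-- Pullback of forms commutes with the sum defining the power. Hence the components of `Pⁿ` are
polynomials in those of `P`, and they inherit its smoothness. -/
theorem inTriv_fieldPow (n : ℕ) (P : MultivectorField 𝕜 (E := E) M (Fin 2)) (m x : M) :
    inTriv (fieldPow n P) m x = wedgePow n (inTriv P m x) := by
  ext v
  rw [inTriv_apply, wedgePow_apply]
  refine (wedgePow_apply n (V := TangentSpace 𝓘(𝕜, E) x) (P x) _).trans ?_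
  congr 1
  refine Finset.sum_congr rfl fun σ _ => ?_
  congr 1
  refine Finset.prod_congr rfl fun i _ => ?_
  rw [inTriv_apply]
  congr 1
  ext1 a
  fin_cases a <;> rfl

theorem contMDiffAt_inTriv {ι : Type*} [Fintype ι] {s : MultivectorField 𝕜 (E := E) M ι}
    (hs : IsSmooth s) (m : M) :
    ContMDiffAt 𝓘(𝕜, E) 𝓘(𝕜, MultivectorModel 𝕜 E ι) ∞ (inTriv s m) m :=
  (Bundle.contMDiffAt_totalSpace.1 (hs m)).2

theorem contMDiffAt_inTriv_apply {ι : Type*} [Fintype ι]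
    {s : MultivectorField 𝕜 (E := E) M ι} (hs : IsSmooth s) (m : M) (v : ι → E →L[𝕜] 𝕜) :
    ContMDiffAt 𝓘(𝕜, E) 𝓘(𝕜, 𝕜) ∞ (fun x => inTriv s m x v) m := by
  have h : ContDiff 𝕜 ∞ fun Q : MultivectorModel 𝕜 E ι => Q v :=
    ContinuousLinearMap.contDiff (𝕜 := 𝕜) (E := MultivectorModel 𝕜 E ι) (F := 𝕜)
      (ContinuousAlternatingMap.apply 𝕜 (E →L[𝕜] 𝕜) 𝕜 v)
  exact h.contMDiff.contMDiffAt.comp m (contMDiffAt_inTriv hs m)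

theorem contMDiffAt_wedgePow_inTriv_apply {P : MultivectorField 𝕜 (E := E) M (Fin 2)}
    (hP : IsSmooth P) (m : M) (n : ℕ) (v : Fin n × Fin 2 → E →L[𝕜] 𝕜) :
    ContMDiffAt 𝓘(𝕜, E) 𝓘(𝕜, 𝕜) ∞ (fun x => wedgePow n (inTriv P m x) v) m := by
  simp only [wedgePow_apply]
  exact contMDiffAt_const_mul_sum_prod _ _ _ m fun σ i =>
    contMDiffAt_inTriv_apply hP m ![v (σ (i, 0)), v (σ (i, 1))]

theorem mfderiv_toTotal {ι : Type*} [Fintype ι] (s : MultivectorField 𝕜 (E := E) M ι) (m : M)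
    (L : E →L[𝕜] MultivectorModel 𝕜 E ι)
    (h : HasMFDerivAt 𝓘(𝕜, E) 𝓘(𝕜, MultivectorModel 𝕜 E ι) (inTriv s m) m L) :
    mfderiv 𝓘(𝕜, E) (𝓘(𝕜, E).prod 𝓘(𝕜, MultivectorModel 𝕜 E ι)) (toTotal s) m =
      (ContinuousLinearMap.id 𝕜 E).prod L := by
  have h' := hasMFDerivAt_section (𝕜 := 𝕜) (EB := E) (B := M) (F := MultivectorModel 𝕜 E ι)
    (Z := Multivector 𝕜 (E := E) (M := M) ι) s m (by exact L) (by exact h)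
  exact h'.mfderiv

/-- A section which vanishes at `m` and is locally `u • f₀` there meets the zero section
transversely at `m` if `f₀` spans the fibre and `du ≠ 0`. -/
theorem transverse_of_hasMFDerivAt {ι : Type*} [Fintype ι] (s : MultivectorField 𝕜 (E := E) M ι)
    (m : M) (f₀ : MultivectorModel 𝕜 E ι) (hf₀ : ∀ g, ∃ k : 𝕜, g = k • f₀) (u : M → 𝕜)
    (hu : inTriv s m = fun x => u x • f₀) (du : E →L[𝕜] 𝕜)
    (hdu : HasMFDerivAt 𝓘(𝕜, E) 𝓘(𝕜, 𝕜) u m du) (hne : du ≠ 0) :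
    LinearMap.range
        (mfderiv 𝓘(𝕜, E) (𝓘(𝕜, E).prod 𝓘(𝕜, MultivectorModel 𝕜 E ι)) (toTotal s) m :
          E →L[𝕜] E × MultivectorModel 𝕜 E ι).toLinearMap ⊔
      LinearMap.range
        (mfderiv 𝓘(𝕜, E) (𝓘(𝕜, E).prod 𝓘(𝕜, MultivectorModel 𝕜 E ι))
          (toTotal (0 : MultivectorField 𝕜 (E := E) M ι)) m :
          E →L[𝕜] E × MultivectorModel 𝕜 E ι).toLinearMap = ⊤ := by
  have hs : HasMFDerivAt 𝓘(𝕜, E) 𝓘(𝕜, MultivectorModel 𝕜 E ι) (inTriv s m) m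
      (du.smulRight f₀) := by
    rw [hu]
    exact hasMFDerivAt_smul_const (F := MultivectorModel 𝕜 E ι) hdu f₀
  have h0 : HasMFDerivAt 𝓘(𝕜, E) 𝓘(𝕜, MultivectorModel 𝕜 E ι)
      (inTriv (0 : MultivectorField 𝕜 (E := E) M ι) m) m
      (0 : E →L[𝕜] MultivectorModel 𝕜 E ι) := by
    have : inTriv (0 : MultivectorField 𝕜 (E := E) M ι) m = fun _ => 0 := by
      funext x
      ext v
      rw [inTriv_apply]
      rfl
    rw [this]
    exact hasMFDerivAt_const _ _
  have e1 := mfderiv_toTotal s m _ hs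
  have e2 := mfderiv_toTotal _ m _ h0
  have key := range_prod_sup_range_prod_zero (𝕜 := 𝕜) (E := E) (F := MultivectorModel 𝕜 E ι)
    f₀ hf₀ hne
  rw [e1, e2]
  exact key

end Manifold

theorem eval_eq_of_monic {R : Type*} [CommRing R] {q : R[X]} {n : ℕ} (hq : q.Monic)
    (hn : q.natDegree = n) (c : R) : q.eval c = c ^ n + ∑ i : Fin n, q.coeff i * c ^ (i : ℕ) := by
  rw [eval_eq_sum_range, hn, Finset.sum_range_succ, ← Fin.sum_univ_eq_sum_range
    (fun i => q.coeff i * c ^ i), ← hn, hq.coeff_natDegree, one_mul, add_comm]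

/-! ### The Pfaffian map and transversality of the power -/

section Manifold

variable {𝕜 : Type*} [RCLike 𝕜] {E : Type*} [NormedAddCommGroup E] [NormedSpace 𝕜 E]
  [FiniteDimensional 𝕜 E] {n : ℕ} {M : Type*} [TopologicalSpace M] [ChartedSpace E M]
  [IsManifold 𝓘(𝕜, E) ∞ M]

/-- The value at `c` of the Pfaffian polynomial with coefficients `a`. -/
def pfaffianValue (n : ℕ) (c : 𝕜) (a : Fin n → 𝕜) : 𝕜 :=
  c ^ n + ∑ i : Fin n, a i * c ^ (i : ℕ)

theorem fieldPow_sub_smul (hE : Module.finrank 𝕜 E = 2 * n)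
    (P₁ P₂ : MultivectorField 𝕜 (E := E) M (Fin 2)) (h₁ : IsNondegenerate P₁) (c : 𝕜) (x : M) :
    fieldPow n (P₂ - c • P₁) x =
      ((-1) ^ n * pfaffianValue n c (pfaffianMap n P₁ P₂ h₁ x)) • fieldPow n P₁ x := by
  have hx : Module.finrank 𝕜 (TangentSpace 𝓘(𝕜, E) x) = 2 * n := hE
  let S := LinearEquiv.ofBijective (fieldSharp P₁ x) (h₁ x)
  have hS : S.toLinearMap = sharp (V := TangentSpace 𝓘(𝕜, E) x) (P₁ x) := rfl
  obtain ⟨hm, hd⟩ := pfaffianPolynomial_recursion_monic (V := TangentSpace 𝓘(𝕜, E) x) hx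
    (P₁ x) (P₂ x) S hS
  have h := wedgePow_sub_smul (V := TangentSpace 𝓘(𝕜, E) x) hx (P₁ x) (P₂ x) S hS c
  rw [eval_eq_of_monic hm hd] at h
  exact h

theorem fieldPow_ne_zero (hE : Module.finrank 𝕜 E = 2 * n)
    {P : MultivectorField 𝕜 (E := E) M (Fin 2)} (h : IsNondegenerate P) (x : M) :
    fieldPow n P x ≠ 0 :=
  have hx : Module.finrank 𝕜 (TangentSpace 𝓘(𝕜, E) x) = 2 * n := hE
  wedgePow_ne_zero (V := TangentSpace 𝓘(𝕜, E) x) hx (h x).1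

theorem hasFDerivAt_pfaffianValue (c : 𝕜) (a : Fin n → 𝕜) :
    HasFDerivAt (pfaffianValue n c)
      (∑ i : Fin n, c ^ (i : ℕ) • ContinuousLinearMap.proj (R := 𝕜) (φ := fun _ : Fin n => 𝕜) i)
      a := by
  have h : HasFDerivAt (fun a : Fin n → 𝕜 => ∑ i : Fin n, a i * c ^ (i : ℕ))
      (∑ i : Fin n, c ^ (i : ℕ) • ContinuousLinearMap.proj (R := 𝕜) (φ := fun _ : Fin n => 𝕜) i)
      a :=
    HasFDerivAt.fun_sum fun i _ => (hasFDerivAt_apply i a).mul_const _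
  exact h.const_add _

/-- The Pfaffian value of a submersive coefficient map has nonzero differential at its zeros. -/
theorem exists_hasMFDerivAt_pfaffianValue {p : M → Fin n → 𝕜} {m : M}
    (hp : Manifold.IsSubmersionAt 𝓘(𝕜, E) 𝓘(𝕜, Fin n → 𝕜) ∞ p m) {c : 𝕜}
    (h0 : pfaffianValue n c (p m) = 0) :
    ∃ dg : E →L[𝕜] 𝕜, dg ≠ 0 ∧
      HasMFDerivAt 𝓘(𝕜, E) 𝓘(𝕜, 𝕜) (fun x => pfaffianValue n c (p x)) m dg := by
  -- For `n = 0` the Pfaffian value is the constant `1`, which contradicts `h0`.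
  have hn : 0 < n := by
    rcases Nat.eq_zero_or_pos n with rfl | h
    · simp [pfaffianValue] at h0
    · exact h
  have hpd : MDifferentiableAt 𝓘(𝕜, E) 𝓘(𝕜, Fin n → 𝕜) p m :=
    hp.contMDiffAt.mdifferentiableAt (by simp)
  have hsurj := mfderiv_surjective_of_isSubmersionAt (by simp) hp
  refine ⟨_, ?_, (hasFDerivAt_pfaffianValue c (p m)).hasMFDerivAt.comp m hpd.hasMFDerivAt⟩
  intro h
  -- The constant coefficient enters with weight `c ^ 0 = 1`, so this direction detects the
  -- differential for every `c`, including `c = 0`.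
  obtain ⟨w, hw⟩ := hsurj (Pi.single (⟨0, hn⟩ : Fin n) (1 : 𝕜))
  have h1 : (∑ i : Fin n, c ^ (i : ℕ) •
      ContinuousLinearMap.proj (R := 𝕜) (φ := fun _ : Fin n => 𝕜) i)
        (mfderiv 𝓘(𝕜, E) 𝓘(𝕜, Fin n → 𝕜) p m w) = 0 := congrArg (fun T => T w) h
  rw [hw] at h1
  simp [Pi.single_apply] at h1

/-- In the trivialization at `m` the frame `P₁ⁿ` varies with the point, so it is written as a scalar
function times its value at `m`. The section becomes `g k` times a fixed vector, and at a zero of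
`g` the product rule leaves `k m • dg`, which is nonzero. -/
theorem isTransverseToZero_fieldPow (hE : Module.finrank 𝕜 E = 2 * n)
    (P₁ P₂ : MultivectorField 𝕜 (E := E) M (Fin 2)) (hP₁ : IsSmooth P₁)
    (h₁ : IsNondegenerate P₁)
    (hp : Manifold.IsSubmersion 𝓘(𝕜, E) 𝓘(𝕜, Fin n → 𝕜) ∞ (pfaffianMap n P₁ P₂ h₁)) (c : 𝕜) :
    IsTransverseToZero (fieldPow n (P₂ - c • P₁)) := by
  intro m hm
  let g (x : M) : 𝕜 := pfaffianValue n c (pfaffianMap n P₁ P₂ h₁ x)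
  have hg0 : g m = 0 := by
    rw [fieldPow_sub_smul hE P₁ P₂ h₁] at hm
    by_contra hg
    refine fieldPow_ne_zero hE h₁ m (ContinuousAlternatingMap.ext fun v => ?_)
    have hv : ((-1) ^ n * g m) * fieldPow n P₁ m v = 0 := congrArg (fun f => f v) hm
    exact (mul_eq_zero.1 hv).resolve_left
      (mul_ne_zero (pow_ne_zero _ (neg_ne_zero.2 one_ne_zero)) hg)
  obtain ⟨dg, hdg, hgd⟩ := exists_hasMFDerivAt_pfaffianValue (hp.isSubmersionAt m) hg0
  obtain ⟨e⟩ := exists_basis_dual (V := E) hE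
  let w (x : M) : MultivectorModel 𝕜 E (Fin n × Fin 2) := wedgePow n (inTriv P₁ m x)
  have hw (x : M) : inTriv (fieldPow n P₁) m x = w x := inTriv_fieldPow n P₁ m x
  have hwm : w m ≠ 0 := by
    rw [← hw]
    exact inTriv_self_ne_zero (fieldPow_ne_zero hE h₁ m)
  have hwme : w m e ≠ 0 := fun h => hwm (top_multivector_eq e h)
  -- The factor `k` collects the sign `(-1)ⁿ` and the ratio of `P₁ⁿ` at `x` to its value at `m`,
  -- measured on `e`; at `m` it equals `(-1)ⁿ`.
  let k (x : M) : 𝕜 := (-1) ^ n * (w m e)⁻¹ * w x e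
  have hk : MDifferentiableAt 𝓘(𝕜, E) 𝓘(𝕜, 𝕜) k m :=
    (contMDiffAt_const.mul (contMDiffAt_wedgePow_inTriv_apply hP₁ m n e)).mdifferentiableAt
      (by simp)
  have hkm : k m ≠ 0 := by
    simp only [k]
    rw [mul_assoc, inv_mul_cancel₀ hwme, mul_one]
    exact pow_ne_zero _ (neg_ne_zero.2 one_ne_zero)
  refine transverse_of_hasMFDerivAt _ m (w m)
    (exists_smul_eq_of_top_multivector (V := E) hE hwm) (fun x => g x * k x) ?_
    (k m • dg) ?_ (smul_ne_zero hkm hdg)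
  · funext x
    refine top_multivector_eq e ?_
    have h1 : inTriv (fieldPow n (P₂ - c • P₁)) m x e = (-1) ^ n * g x * w x e := by
      rw [inTriv_apply, fieldPow_sub_smul hE P₁ P₂ h₁, ← hw, inTriv_apply]
      rfl
    rw [h1, ContinuousAlternatingMap.smul_apply, smul_eq_mul]
    simp only [k]
    field_simp
  · exact hasMFDerivAt_mul_of_eq_zero hgd hg0 hk

end Manifold

end BiPoisson

theorem mainTheorem7 {𝕜 : Type*} [RCLike 𝕜] {E : Type*} [NormedAddCommGroup E] [NormedSpace 𝕜 E]
    [FiniteDimensional 𝕜 E] (n : ℕ) (hE : Module.finrank 𝕜 E = 2 * n)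
    {M : Type*} [TopologicalSpace M] [ChartedSpace E M] [IsManifold 𝓘(𝕜, E) ∞ M]
    (P₁ P₂ : BiPoisson.MultivectorField 𝕜 (E := E) M (Fin 2))
    (hP : BiPoisson.IsBiPoisson P₁ P₂) (h₁ : BiPoisson.IsNondegenerate P₁)
    (hp : Manifold.IsSubmersion 𝓘(𝕜, E) 𝓘(𝕜, Fin n → 𝕜) ∞ (BiPoisson.pfaffianMap n P₁ P₂ h₁))
    (c : 𝕜) :
    BiPoisson.IsLogSymplectic n (P₂ - c • P₁) := by
  -- Smoothness of `P₁` is contained in the pencil condition at `(t₁, t₂) = (1, 0)`, just as the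
  -- Poisson property of `P₂ - c P₁` is at `(-c, 1)`.
  have hP₁ : BiPoisson.IsSmooth P₁ := by
    have h : (1 : 𝕜) • P₁ + (0 : 𝕜) • P₂ = P₁ := by
      funext x
      ext v
      change (1 : 𝕜) * P₁ x v + 0 * P₂ x v = P₁ x v
      ring
    exact h ▸ (hP.isPoisson 1 0).smooth
  refine ⟨?_, BiPoisson.isTransverseToZero_fieldPow hE P₁ P₂ hP₁ h₁ hp c⟩
  have h : (-c) • P₁ + (1 : 𝕜) • P₂ = P₂ - c • P₁ := by
    funext x
    ext v
    change -c * P₁ x v + 1 * P₂ x v = P₂ x v - c * P₁ x v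
    ring
  exact h ▸ hP.isPoisson (-c) 1
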